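/- Let $\alpha>0$, $a\in\mathbb R$, $\sigma\in\mathbb R\setminus\{0\}$, and let $(k_n)_{n\ge 1}$ be a sequence of positive numbers that is regularly varying with index $-1-\alpha$, i.e. $k_{\lfloor \lambda n\rfloor}/k_n\to\lambda^{-1-\alpha}$ as $n\to\infty$ for every $\lambda>0$. (Then $\sum_{j\ge1}k_j<\infty$.) Suppose that $$a+\sum_{j=1}^\infty k_j<0 .$$ Let $(r_n)_{n\ge0}$ be the fundamental solution defined by $r_0=1$ and $$r_{n+1}-r_n=a r_n+\sum_{j=1}^{n}k_j r_{n-j},\qquad n\ge 0 .$$ If $a<-1$, assume in addition that $\sum_{n\ge 0}|r_n|<\infty$. (If $a\ge -1$, this holds automatically.) Let $(\xi_n)_{n\in\mathbb Z}$ be independent, identically distributed random variables with $\mathbb E\,\xi_n=0$ and $\mathbb E\,\xi_n^2=\sigma^2$. Then there is a process $X=(X_n)_{n\in\mathbb Z}$, on the same probability space, with $$X_{n+1}-X_n=aX_n+\sum_{j=1}^\infty k_jX_{n-j}+\xi_{n+1}\quad(n\ge 0),\qquad X_n=\sum_{j=-\infty}^{n}r_{n-j}\,\xi_j\quad (n\le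 0),$$ where the random series converge in probability. For every such process, each $X_n$ is square integrable, the autocovariance $c(h)=\operatorname{Cov}(X_n,X_{n+h})$, $h\in\mathbb N$, does not depend on $n\in\mathbb Z$, and $$\lim_{h\to\infty}\frac{c(h)}{k_h}=\frac{\sigma^2}{\bigl(-a-\sum_{j=1}^\infty k_j\bigr)^3}>0 .$$ -/

import Mathlib

open MeasureTheory ProbabilityTheory Filter Topology

/-- A sequence of positive numbers `(k n)`, `n ≥ 1`, is regularly varying of index `ρ` if
`k ⌊l n⌋ / k n → l ^ ρ` for every `l > 0`. The value `k 0` plays no role. -/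
def IsRegularlyVaryingSeq (k : ℕ → ℝ) (ρ : ℝ) : Prop :=
  (∀ n : ℕ, 1 ≤ n → 0 < k n) ∧
    ∀ l : ℝ, 0 < l → Tendsto (fun n : ℕ => k ⌊l * (n : ℝ)⌋₊ / k n) atTop (𝓝 (l ^ ρ))

/-- `r` is the fundamental solution of the Volterra difference equation:
`r 0 = 1` and `r (n+1) - r n = a r n + ∑_{j=1}^n k j r (n-j)` for `n ≥ 0`. -/
def IsFundamentalSolution (a : ℝ) (k r : ℕ → ℝ) : Prop :=
  r 0 = 1 ∧
    ∀ n : ℕ, r (n + 1) - r n = a * r n + ∑ j ∈ Finset.Icc 1 n, k j * r (n - j)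

/-- `ξ` is a two-sided sequence of independent, identically distributed random variables with
mean zero and finite second moment `σ ^ 2`. -/
structure IsIIDNoise {Ω : Type*} [MeasurableSpace Ω] (μ : Measure Ω) (ξ : ℤ → Ω → ℝ)
    (σ : ℝ) : Prop where
  measurable : ∀ n, Measurable (ξ n)
  indep : iIndepFun ξ μ
  identDistrib : ∀ n, IdentDistrib (ξ n) (ξ 0) μ μ
  memLp : ∀ n, MemLp (ξ n) 2 μ
  mean : ∀ n, ∫ ω, ξ n ω ∂μ = 0
  second_moment : ∀ n, ∫ ω, ξ n ω ^ 2 ∂μ = σ ^ 2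

/-- `X` solves the Volterra difference equation with infinite memory
`X (n+1) - X n = a X n + ∑_{j=1}^∞ k j X (n-j) + ξ (n+1)` for `n ≥ 0`, with
`X n = ∑_{j=-∞}^n r (n-j) ξ j` for `n ≤ 0`.
Both random series are required to converge in probability only (this is implied by almost sure
convergence and by convergence in mean square, and determines the sum almost surely);
the second one is written with the summation index `m = n - j ≥ 0`. -/
structure IsVolterraProcess {Ω : Type*} [MeasurableSpace Ω] (μ : Measure Ω)
    (a : ℝ) (k r : ℕ → ℝ) (ξ X : ℤ → Ω → ℝ) : Prop where
  aemeasurable : ∀ n, AEMeasurable (X n) μ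
  recurrence : ∀ n : ℤ, 0 ≤ n →
    TendstoInMeasure μ
      (fun (M : ℕ) (ω : Ω) => ∑ j ∈ Finset.Icc 1 M, k j * X (n - (j : ℤ)) ω) atTop
      (fun ω => X (n + 1) ω - X n ω - a * X n ω - ξ (n + 1) ω)
  past : ∀ n : ℤ, n ≤ 0 →
    TendstoInMeasure μ
      (fun (M : ℕ) (ω : Ω) => ∑ m ∈ Finset.range M, r m * ξ (n - (m : ℤ)) ω) atTop (X n)

/-- `c` is the autocovariance function of the square integrable process `X`:
`Cov (X n, X (n+h)) = c h` for all times `n`, so it does not depend on `n`. -/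
structure IsAutocovariance {Ω : Type*} [MeasurableSpace Ω] (μ : Measure Ω)
    (X : ℤ → Ω → ℝ) (c : ℕ → ℝ) : Prop where
  memLp : ∀ n, MemLp (X n) 2 μ
  cov_eq : ∀ (n : ℤ) (h : ℕ), cov[X n, X (n + (h : ℤ)); μ] = c h

/-! Put `q 0 = 1 + a` and `q n = k n` for `n ≥ 1`. Then `r (n+1)` is the `n`th term of the
convolution of `q` and `r`, so the generating functions satisfy R(z)(1 - zQ(z)) = 1. Since `r` is
summable, ∑ r = 1/(-a - ∑ k). In L² the only solution is the moving average ∑ r_m ξ_{n-m}, so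
orthogonality of the noise gives c(h) = σ² ∑ r_j r_{j+h}. If r_n/k_n → (∑ r)², dominated convergence
gives c(h)/k_h → σ² (∑ r)³, which is the claim. The asymptotics of `r` are the core
(`IsSubexponentialWeight.tendsto_renewal`). Let D = 1 - zQ and let t be a truncation of R = 1/D.
Then e = 1 - tD = (R - t)D has small ℓ¹ norm, and R = t + eR. Split the convolution eR at half its
length: the terms with small index of `r` have explicit asymptotics, and the others form a
contraction in the sup norm weighted by 1/`k`. Regular variation enters only through the properties
in `IsSubexponentialWeight`. They rest on a uniform convergence theorem and on 2^(-1-α) < 1/2. -/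

/-! ### Regularly varying sequences. -/

theorem min_one_abs_sub_le (x y z : ℝ) :
    min 1 |x - z| ≤ min 1 |x - y| + min 1 |y - z| := by
  have h := abs_sub_le x y z
  have h1 := abs_nonneg (x - y)
  have h2 := abs_nonneg (y - z)
  rcases le_total 1 |x - y| with h3 | h3 <;> rcases le_total 1 |y - z| with h4 | h4 <;>
    simp only [min_eq_left, min_eq_right, h3, h4] <;>
    [skip; skip; skip; exact (min_le_right _ _).trans h] <;>
    exact (min_le_left _ _).trans (by linarith)

/-- The average of `min 1 |L p - L n|` over `n ≤ p < 3n` tends to zero, if `L` is additively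
slowly varying. -/
theorem tendsto_average_of_slowlyVarying {L : ℕ → ℝ}
    (hL : ∀ l : ℝ, 0 < l → Tendsto (fun n : ℕ => L ⌊l * (n : ℝ)⌋₊ - L n) atTop (𝓝 0)) :
    Tendsto (fun n : ℕ => (∑ p ∈ Finset.Ico n (3 * n), min 1 |L p - L n|) / n) atTop (𝓝 0) := by
  have hmeas : ∀ n : ℕ, Measurable fun u : ℝ => min 1 |L ⌊u * (n : ℝ)⌋₊ - L n| := by
    intro n
    have h1 : Measurable fun u : ℝ => ⌊u * (n : ℝ)⌋₊ :=
      Nat.measurable_floor.comp (measurable_id.mul_const _)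
    have h2 : Measurable fun p : ℕ => min 1 |L p - L n| := measurable_from_nat
    exact h2.comp h1
  have hint : ∀ (n : ℕ) (x y : ℝ), IntervalIntegrable
      (fun u : ℝ => min 1 |L ⌊u * (n : ℝ)⌋₊ - L n|) volume x y := by
    intro n x y
    refine (intervalIntegrable_const (c := (1 : ℝ))).mono_fun
      (hmeas n).aestronglyMeasurable ?_
    refine Eventually.of_forall fun u => ?_
    have h0 : 0 ≤ min 1 |L ⌊u * (n : ℝ)⌋₊ - L n| := by positivity
    simp [abs_of_nonneg h0]
  have hlim : Tendsto (fun n : ℕ => ∫ u in (1 : ℝ)..3, min 1 |L ⌊u * (n : ℝ)⌋₊ - L n|) atTop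
      (𝓝 (∫ _u in (1 : ℝ)..3, (0 : ℝ))) := by
    refine intervalIntegral.tendsto_integral_filter_of_dominated_convergence (fun _ => 1)
      (Eventually.of_forall fun n => (hmeas n).aestronglyMeasurable) ?_
      intervalIntegrable_const ?_
    · refine Eventually.of_forall fun n => Eventually.of_forall fun u _ => ?_
      rw [Real.norm_of_nonneg (by positivity)]
      exact min_le_left _ _
    · refine Eventually.of_forall fun u hu => ?_
      rw [Set.uIoc_of_le (by norm_num)] at hu
      have h := (hL u (by linarith [hu.1])).abs
      simpa using (tendsto_const_nhds (x := (1 : ℝ))).min h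
  simp only [intervalIntegral.integral_zero] at hlim
  refine hlim.congr' ?_
  filter_upwards [eventually_gt_atTop 0] with n hn
  have hn' : (0 : ℝ) < n := by exact_mod_cast hn
  -- The integrand is constant on each open cell (p/n, (p+1)/n), where the floor is `p`; so the
  -- integral over [1,3] is the sum divided by `n`.
  have hsum := intervalIntegral.sum_integral_adjacent_intervals_Ico (μ := volume)
    (f := fun u : ℝ => min 1 |L ⌊u * (n : ℝ)⌋₊ - L n|) (a := fun p : ℕ => (p : ℝ) / n)
    (m := n) (n := 3 * n) (by omega) (fun p _ => hint n _ _)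
  have e1 : ((n : ℕ) : ℝ) / n = 1 := div_self hn'.ne'
  have e3 : ((3 * n : ℕ) : ℝ) / n = 3 := by push_cast; field_simp
  rw [e1, e3] at hsum
  rw [← hsum, Finset.sum_div]
  refine Finset.sum_congr rfl fun p _ => ?_
  have hle : (p : ℝ) / n ≤ ((p + 1 : ℕ) : ℝ) / n := by
    gcongr; simp
  have hcell : ∫ u in ((p : ℝ) / n)..(((p + 1 : ℕ) : ℝ) / n),
      min 1 |L ⌊u * (n : ℝ)⌋₊ - L n| =
      ∫ _u in ((p : ℝ) / n)..(((p + 1 : ℕ) : ℝ) / n), min 1 |L p - L n| := by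
    refine intervalIntegral.integral_congr_ae_restrict ?_
    rw [Set.uIoc_of_le hle, ← restrict_Ioo_eq_restrict_Ioc]
    refine (ae_restrict_mem measurableSet_Ioo).mono fun u hu => ?_
    have hfl : ⌊u * (n : ℝ)⌋₊ = p := by
      rw [Nat.floor_eq_iff (mul_nonneg ((by positivity : (0 : ℝ) ≤ p / n).trans hu.1.le) hn'.le)]
      have h1 := (div_lt_iff₀ hn').1 hu.1
      have h2 := (lt_div_iff₀ hn').1 hu.2
      push_cast at h2
      exact ⟨h1.le, h2⟩
    simp only [hfl]
  rw [hcell, intervalIntegral.integral_const, smul_eq_mul]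
  push_cast
  field_simp
  ring

/-- Uniform convergence theorem for additively slowly varying sequences. -/
theorem eventually_abs_sub_le_of_slowlyVarying {L : ℕ → ℝ}
    (hL : ∀ l : ℝ, 0 < l → Tendsto (fun n : ℕ => L ⌊l * (n : ℝ)⌋₊ - L n) atTop (𝓝 0))
    {ε : ℝ} (hε : 0 < ε) :
    ∀ᶠ n : ℕ in atTop, ∀ m, n ≤ m → m ≤ 2 * n → |L m - L n| ≤ ε := by
  have hlim := tendsto_average_of_slowlyVarying hL
  -- As δ < 1, a truncated difference below δ is the difference itself. The windows [n,3n) and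
  -- [m,3m) share the `n` points of [2n,3n). With average δ/3 on each and m ≤ 2n, the total is below
  -- nδ/3 + 2nδ/3 = nδ.
  set δ := min ε (1 / 2) with hδ
  have hδ0 : 0 < δ := lt_min hε (by norm_num)
  have hev := hlim.eventually (gt_mem_nhds (show (0 : ℝ) < δ / 3 by positivity))
  obtain ⟨N, hN⟩ := eventually_atTop.1 hev
  filter_upwards [eventually_ge_atTop (max N 1)] with n hn m hnm hmn
  have hn1 : 1 ≤ n := (le_max_right _ _).trans hn
  have hnN : N ≤ n := (le_max_left _ _).trans hn
  have hn' : (0 : ℝ) < n := by exact_mod_cast hn1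
  have hm' : (0 : ℝ) < m := by exact_mod_cast hn1.trans hnm
  have h1 := (div_lt_iff₀ hn').1 (hN n hnN)
  have h2 := (div_lt_iff₀ hm').1 (hN m (hnN.trans hnm))
  have hsub1 : ∑ p ∈ Finset.Ico (2 * n) (3 * n), min 1 |L p - L n| ≤
      ∑ p ∈ Finset.Ico n (3 * n), min 1 |L p - L n| :=
    Finset.sum_le_sum_of_subset_of_nonneg (Finset.Ico_subset_Ico (by omega) le_rfl)
      fun _ _ _ => by positivity
  have hsub2 : ∑ p ∈ Finset.Ico (2 * n) (3 * n), min 1 |L p - L m| ≤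
      ∑ p ∈ Finset.Ico m (3 * m), min 1 |L p - L m| :=
    Finset.sum_le_sum_of_subset_of_nonneg (Finset.Ico_subset_Ico hmn (by omega))
      fun _ _ _ => by positivity
  have htri : (n : ℝ) * min 1 |L m - L n| ≤
      ∑ p ∈ Finset.Ico (2 * n) (3 * n), (min 1 |L p - L m| + min 1 |L p - L n|) := by
    have : ∑ _p ∈ Finset.Ico (2 * n) (3 * n), min 1 |L m - L n| ≤
        ∑ p ∈ Finset.Ico (2 * n) (3 * n), (min 1 |L p - L m| + min 1 |L p - L n|) := by
      refine Finset.sum_le_sum fun p _ => ?_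
      have := min_one_abs_sub_le (L m) (L p) (L n)
      rwa [abs_sub_comm (L m) (L p)] at this
    rwa [Finset.sum_const, Nat.card_Ico, nsmul_eq_mul, show 3 * n - 2 * n = n by omega] at this
  rw [Finset.sum_add_distrib] at htri
  have hmn' : (m : ℝ) ≤ 2 * n := by exact_mod_cast hmn
  have hlt : (n : ℝ) * min 1 |L m - L n| < n * δ := by nlinarith
  have hlt' := lt_of_mul_lt_mul_left hlt hn'.le
  rcases min_lt_iff.1 hlt' with h | h
  · linarith [min_le_right ε (1 / 2 : ℝ)]
  · exact (h.trans_le (min_le_left _ _)).le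

/-- The slowly varying part of a regularly varying sequence, in logarithmic form. -/
theorem IsRegularlyVaryingSeq.tendsto_log_sub {k : ℕ → ℝ} {ρ : ℝ}
    (hk : IsRegularlyVaryingSeq k ρ) (l : ℝ) (hl : 0 < l) :
    Tendsto (fun n : ℕ => (Real.log (k ⌊l * (n : ℝ)⌋₊) - ρ * Real.log (⌊l * (n : ℝ)⌋₊ : ℝ)) -
      (Real.log (k n) - ρ * Real.log n)) atTop (𝓝 0) := by
  have h1 : Tendsto (fun n : ℕ => Real.log (k ⌊l * (n : ℝ)⌋₊ / k n)) atTop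
      (𝓝 (Real.log (l ^ ρ))) :=
    (hk.2 l hl).log (Real.rpow_pos_of_pos hl ρ).ne'
  have h2 : Tendsto (fun n : ℕ => Real.log ((⌊l * (n : ℝ)⌋₊ : ℝ) / n)) atTop
      (𝓝 (Real.log l)) :=
    ((tendsto_nat_floor_mul_div_atTop hl.le).comp tendsto_natCast_atTop_atTop).log hl.ne'
  have h3 := h1.sub (h2.const_mul ρ)
  rw [Real.log_rpow hl, sub_self] at h3
  refine h3.congr' ?_
  have h4 : ∀ᶠ n : ℕ in atTop, 1 ≤ l * (n : ℝ) :=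
    (tendsto_natCast_atTop_atTop.const_mul_atTop hl).eventually_ge_atTop 1
  filter_upwards [h4, eventually_gt_atTop 0] with n hn hn0
  have hf : 1 ≤ ⌊l * (n : ℝ)⌋₊ := Nat.one_le_floor_iff _ |>.2 hn
  rw [Real.log_div (hk.1 _ hf).ne' (hk.1 _ hn0).ne', Real.log_div
    (by exact_mod_cast (by omega : ⌊l * (n : ℝ)⌋₊ ≠ 0)) (by exact_mod_cast hn0.ne')]
  ring

theorem IsRegularlyVaryingSeq.eventually_log_le {k : ℕ → ℝ} {ρ : ℝ}
    (hk : IsRegularlyVaryingSeq k ρ) {ε : ℝ} (hε : 0 < ε) :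
    ∀ᶠ n : ℕ in atTop, ∀ m, n ≤ m → m ≤ 2 * n →
      |(Real.log (k m) - Real.log (k n)) - ρ * (Real.log m - Real.log n)| ≤ ε := by
  filter_upwards [eventually_abs_sub_le_of_slowlyVarying
    (L := fun n => Real.log (k n) - ρ * Real.log n) hk.tendsto_log_sub hε] with n hn m h1 h2
  convert hn m h1 h2 using 2
  ring

theorem tendsto_log_natCast_succ_sub_log :
    Tendsto (fun n : ℕ => Real.log ((n + 1 : ℕ) : ℝ) - Real.log n) atTop (𝓝 0) := by
  have h : Tendsto (fun n : ℕ => Real.log (1 + 1 / (n : ℝ))) atTop (𝓝 (Real.log (1 + 0))) :=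
    (tendsto_const_nhds.add tendsto_one_div_atTop_nhds_zero_nat).log (by norm_num)
  rw [add_zero, Real.log_one] at h
  refine h.congr' ?_
  filter_upwards [eventually_gt_atTop 0] with n hn
  have hn' : (0 : ℝ) < n := by exact_mod_cast hn
  rw [← Real.log_div (by positivity) hn'.ne']
  congr 1
  push_cast
  field_simp

/-- No fixed dilation compares neighbours, but n + 1 lies in [n, 2n], so the uniform estimate
applies. -/
theorem IsRegularlyVaryingSeq.tendsto_succ_div {k : ℕ → ℝ} {ρ : ℝ}
    (hk : IsRegularlyVaryingSeq k ρ) :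
    Tendsto (fun n : ℕ => k (n + 1) / k n) atTop (𝓝 1) := by
  have h1 : Tendsto (fun n : ℕ => (Real.log (k (n + 1)) - Real.log (k n)) -
      ρ * (Real.log ((n + 1 : ℕ) : ℝ) - Real.log n)) atTop (𝓝 0) := by
    rw [Metric.tendsto_nhds]
    intro ε hε
    filter_upwards [hk.eventually_log_le (half_pos hε), eventually_ge_atTop 1] with n hn hn1
    rw [dist_zero_right, Real.norm_eq_abs]
    exact (hn (n + 1) (by omega) (by omega)).trans_lt (half_lt_self hε)
  have h2 := (h1.add (tendsto_log_natCast_succ_sub_log.const_mul ρ)).rexp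
  simp only [sub_add_cancel, mul_zero, add_zero, Real.exp_zero] at h2
  refine h2.congr' ?_
  filter_upwards [eventually_gt_atTop 0] with n hn
  rw [Real.exp_sub, Real.exp_log (hk.1 _ (by omega)), Real.exp_log (hk.1 _ hn)]

/-- A regularly varying sequence is bounded above and below on dyadic blocks. -/
theorem IsRegularlyVaryingSeq.exists_dyadic_bound {k : ℕ → ℝ} {ρ : ℝ}
    (hk : IsRegularlyVaryingSeq k ρ) :
    ∃ C : ℝ, 1 ≤ C ∧ ∀ᶠ n : ℕ in atTop, ∀ m, n ≤ m → m ≤ 2 * n →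
      k m ≤ C * k n ∧ k n ≤ C * k m := by
  refine ⟨Real.exp (|ρ| * Real.log 2 + 1), Real.one_le_exp (by positivity), ?_⟩
  filter_upwards [hk.eventually_log_le one_pos, eventually_gt_atTop 0] with n hn hn0 m h1 h2
  have hkm := hk.1 m (by omega)
  have hkn := hk.1 n (by omega)
  have hn' : (0 : ℝ) < n := by exact_mod_cast hn0
  have h1' : (n : ℝ) ≤ m := by exact_mod_cast h1
  have h2' : (m : ℝ) ≤ 2 * n := by exact_mod_cast h2
  have hl0 : 0 ≤ Real.log m - Real.log n := sub_nonneg.2 (Real.log_le_log hn' h1')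
  have hl1 : Real.log m - Real.log n ≤ Real.log 2 := by
    have := Real.log_le_log (hn'.trans_le h1') h2'
    rw [Real.log_mul two_ne_zero hn'.ne'] at this
    linarith
  have hρ : |ρ * (Real.log m - Real.log n)| ≤ |ρ| * Real.log 2 := by
    rw [abs_mul, abs_of_nonneg hl0]
    gcongr
  have h3 := abs_le.1 (hn m h1 h2)
  have h4 := abs_le.1 hρ
  constructor
  · rw [← Real.log_le_log_iff hkm (by positivity),
      Real.log_mul (Real.exp_pos _).ne' hkn.ne', Real.log_exp]
    linarith [h3.2, h4.2]
  · rw [← Real.log_le_log_iff hkn (by positivity),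
      Real.log_mul (Real.exp_pos _).ne' hkm.ne', Real.log_exp]
    linarith [h3.1, h4.1]

/-- The doubling ratio tends to 2^(-1-α), which is below 1/2 because α > 0. Neighbouring terms being
equivalent, odd indices behave alike. -/
theorem IsRegularlyVaryingSeq.exists_half_contraction {k : ℕ → ℝ} {α : ℝ} (hα : 0 < α)
    (hk : IsRegularlyVaryingSeq k (-1 - α)) :
    ∃ θ : ℝ, 0 ≤ θ ∧ θ < 1 / 2 ∧ ∀ᶠ n : ℕ in atTop,
      k (2 * n) ≤ θ * k n ∧ k (2 * n + 1) ≤ θ * k n := by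
  have h2 : Tendsto (fun n : ℕ => k (2 * n) / k n) atTop (𝓝 ((2 : ℝ) ^ (-1 - α))) := by
    refine (hk.2 2 two_pos).congr fun n => ?_
    rw [show (2 : ℝ) * n = ((2 * n : ℕ) : ℝ) by push_cast; ring, Nat.floor_natCast]
  have hdbl : Tendsto (fun n : ℕ => 2 * n) atTop atTop :=
    tendsto_id.const_mul_atTop' two_pos
  have h3 : Tendsto (fun n : ℕ => k (2 * n + 1) / k n) atTop (𝓝 ((2 : ℝ) ^ (-1 - α))) := by
    have := (hk.tendsto_succ_div.comp hdbl).mul h2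
    rw [one_mul] at this
    refine this.congr' ?_
    filter_upwards [eventually_gt_atTop 0] with n hn
    exact div_mul_div_cancel₀ (hk.1 (2 * n) (by omega)).ne'
  have hlt : (2 : ℝ) ^ (-1 - α) < 1 / 2 := by
    have := Real.rpow_lt_rpow_of_exponent_lt (x := 2) (by norm_num) (show -1 - α < -1 by linarith)
    rwa [Real.rpow_neg_one, ← one_div] at this
  obtain ⟨θ, h4, h5⟩ := exists_between hlt
  refine ⟨θ, (Real.rpow_nonneg two_pos.le _).trans h4.le, h5, ?_⟩
  filter_upwards [h2.eventually (gt_mem_nhds h4), h3.eventually (gt_mem_nhds h4),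
    eventually_gt_atTop 0] with n h6 h7 hn
  exact ⟨((div_lt_iff₀ (hk.1 n hn)).1 h6).le, ((div_lt_iff₀ (hk.1 n hn)).1 h7).le⟩

/-- A form of Cauchy condensation: the partial sums satisfy S(2M) ≤ S(2N) + 2θ S(M) and S(M) ≤
S(2M), with 2θ < 1. -/
theorem summable_of_half_contraction {w : ℕ → ℝ} (hw : ∀ n, 0 ≤ w n) {θ : ℝ} (hθ0 : 0 ≤ θ)
    (hθ : θ < 1 / 2)
    (h : ∀ᶠ n : ℕ in atTop, w (2 * n) ≤ θ * w n ∧ w (2 * n + 1) ≤ θ * w n) : Summable w := by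
  obtain ⟨N, hN⟩ := eventually_atTop.1 h
  have key : ∀ M, N ≤ M → ∑ p ∈ Finset.range (2 * M), w p ≤
      ∑ p ∈ Finset.range (2 * N), w p + 2 * θ * ∑ p ∈ Finset.range M, w p := by
    intro M hM
    induction M, hM using Nat.le_induction with
    | base =>
      have : 0 ≤ ∑ p ∈ Finset.range N, w p := Finset.sum_nonneg fun i _ => hw i
      nlinarith
    | succ M hM ih =>
      rw [show 2 * (M + 1) = 2 * M + 1 + 1 by ring, Finset.sum_range_succ, Finset.sum_range_succ,
        Finset.sum_range_succ _ M]
      linarith [(hN M hM).1, (hN M hM).2]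
  have hmono : Monotone fun M => ∑ p ∈ Finset.range M, w p :=
    fun i j hij => Finset.sum_le_sum_of_subset_of_nonneg (Finset.range_mono hij) fun _ _ _ => hw _
  refine summable_of_sum_range_le (c := (∑ p ∈ Finset.range (2 * N), w p) / (1 - 2 * θ)) hw
    fun n => (hmono (le_max_left n N)).trans ?_
  rw [le_div_iff₀ (by linarith)]
  have h1 := key (max n N) (le_max_right _ _)
  have h2 := hmono (show max n N ≤ 2 * max n N by omega)
  simp only at h2
  nlinarith

/-- The properties of a regularly varying sequence of index less than `-1` used below: a positive,
summable weight with asymptotically equal neighbouring terms, for which `w m` is controlled by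
`w n` if `m` is at least `n / 2`. -/
structure IsSubexponentialWeight (w : ℕ → ℝ) (C : ℝ) : Prop where
  pos : ∀ n, 0 < w n
  summable : Summable w
  tendsto_succ_div : Tendsto (fun n => w (n + 1) / w n) atTop (𝓝 1)
  le_mul : ∀ m n, n ≤ 2 * m → w m ≤ C * w n

theorem IsRegularlyVaryingSeq.exists_isSubexponentialWeight {k : ℕ → ℝ} {α : ℝ} (hα : 0 < α)
    (hk : IsRegularlyVaryingSeq k (-1 - α)) :
    ∃ C, IsSubexponentialWeight (fun n => if n = 0 then 1 else k n) C := by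
  set w : ℕ → ℝ := fun n => if n = 0 then 1 else k n with hw
  have hwk : ∀ n, 1 ≤ n → w n = k n := fun n hn => by simp [hw, show n ≠ 0 by omega]
  have hpos : ∀ n, 0 < w n := by
    intro n
    rcases Nat.eq_zero_or_pos n with rfl | hn
    · simp [hw]
    · rw [hwk n hn]; exact hk.1 n hn
  obtain ⟨θ, hθ0, hθ, hcon⟩ := hk.exists_half_contraction hα
  have hsum : Summable w := by
    refine summable_of_half_contraction (fun n => (hpos n).le) hθ0 hθ ?_
    filter_upwards [hcon, eventually_gt_atTop 0] with n hn hn0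
    rwa [hwk _ hn0, hwk _ (by omega), hwk _ (by omega)]
  obtain ⟨C₀, hC₀, hdy⟩ := hk.exists_dyadic_bound
  obtain ⟨N, hN⟩ := eventually_atTop.1 (hdy.and (hcon.and (eventually_gt_atTop 0)))
  -- Halve `m` until it lies in [n, 2n]. Each halving costs a factor θ < 1, so the dyadic constant
  -- survives.
  have hup : ∀ n, N ≤ n → ∀ m, n ≤ m → k m ≤ C₀ * k n := by
    intro n hn m
    induction m using Nat.strong_induction_on with
    | _ m ih =>
      intro hm
      rcases le_or_gt m (2 * n) with h | h
      · exact ((hN n hn).1 m hm h).1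
      · have h0 := (hN n hn).2.2
        have h1 : k (m / 2) ≤ C₀ * k n := ih (m / 2) (by omega) (by omega)
        have h2 := (hN (m / 2) (by omega)).2.1
        have h3 := hk.1 (m / 2) (by omega)
        have h4 : k m ≤ θ * k (m / 2) := by
          rcases Nat.mod_two_eq_zero_or_one m with h | h
          · have := h2.1
            rwa [show 2 * (m / 2) = m by omega] at this
          · have := h2.2
            rwa [show 2 * (m / 2) + 1 = m by omega] at this
        nlinarith
  -- For the finitely many small `n`, compare the minimum of `w` with the trivial bound `w m ≤ S`.
  obtain ⟨j, -, hj⟩ := Finset.exists_min_image (Finset.range (2 * N + 1)) w ⟨0, by simp⟩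
  set S := ∑' n, w n with hS
  have hle : ∀ m, w m ≤ S := fun m => hsum.le_tsum m fun i _ => (hpos i).le
  refine ⟨max C₀ (S / w j), hpos, hsum, ?_, ?_⟩
  · refine hk.tendsto_succ_div.congr' ?_
    filter_upwards [eventually_gt_atTop 0] with n hn
    rw [hwk _ hn, hwk _ (by omega)]
  · intro m n hmn
    rcases lt_or_ge n (2 * N) with h | h
    · have h1 := hj n (Finset.mem_range.2 (by omega))
      calc w m ≤ S := hle m
        _ = S / w j * w j := (div_mul_cancel₀ _ (hpos j).ne').symm
        _ ≤ max C₀ (S / w j) * w n := by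
          have : 0 ≤ S := (hpos m).le.trans (hle m)
          have := (hpos j).le
          gcongr
          exact le_max_right _ _
    · have h0 := (hN N le_rfl).2.2
      have h5 : k m ≤ C₀ * k n := by
        rcases le_total m n with h1 | h1
        · exact ((hN m (by omega)).1 n h1 hmn).2
        · exact hup n (by omega) m h1
      rw [hwk m (by omega), hwk n (by omega)]
      have := hk.1 n (by omega)
      exact h5.trans (by gcongr; exact le_max_left _ _)

/-! ### Convolutions and subexponential weights. -/

section Convolution

variable {w : ℕ → ℝ} {C : ℝ}

theorem IsSubexponentialWeight.const_nonneg (hw : IsSubexponentialWeight w C) : 0 ≤ C := by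
  have h := hw.le_mul 0 0 (by simp)
  have := hw.pos 0
  by_contra! hC
  nlinarith

theorem IsSubexponentialWeight.tendsto_add_div (hw : IsSubexponentialWeight w C) (i : ℕ) :
    Tendsto (fun n => w (n + i) / w n) atTop (𝓝 1) := by
  induction i with
  | zero => simp [div_self (hw.pos _).ne']
  | succ i ih =>
    have h := (hw.tendsto_succ_div.comp (tendsto_add_atTop_nat i)).mul ih
    rw [one_mul] at h
    exact h.congr fun n => div_mul_div_cancel₀ (hw.pos (n + i)).ne'

theorem IsSubexponentialWeight.tendsto_sub_div (hw : IsSubexponentialWeight w C) (i : ℕ) :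
    Tendsto (fun n => w (n - i) / w n) atTop (𝓝 1) := by
  rw [← tendsto_add_atTop_iff_nat i]
  simpa using (hw.tendsto_add_div i).inv₀ one_ne_zero

theorem exists_abs_le_mul_of_tendsto_div (hw : ∀ n, 0 < w n) {v : ℕ → ℝ} {V : ℝ}
    (hv : Tendsto (fun n => v n / w n) atTop (𝓝 V)) :
    ∃ B, 0 ≤ B ∧ ∀ n, |v n| ≤ B * w n := by
  obtain ⟨B, hB⟩ := hv.abs.bddAbove_range
  have h : ∀ n, |v n| / w n ≤ B := fun n => by
    have : |v n / w n| ≤ B := hB ⟨n, rfl⟩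
    rwa [abs_div, abs_of_pos (hw n)] at this
  exact ⟨B, (div_nonneg (abs_nonneg _) (hw 0).le).trans (h 0), fun n => (div_le_iff₀ (hw n)).1 (h n)⟩

theorem IsSubexponentialWeight.summable_abs (hw : IsSubexponentialWeight w C) {v : ℕ → ℝ} {V : ℝ}
    (hv : Tendsto (fun n => v n / w n) atTop (𝓝 V)) : Summable fun n => |v n| := by
  obtain ⟨B, -, hB⟩ := exists_abs_le_mul_of_tendsto_div hw.pos hv
  exact Summable.of_nonneg_of_le (fun n => abs_nonneg _) hB (hw.summable.mul_left B)

/-- The asymptotics of the part of a convolution in which the first index is at most half of the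
total. -/
theorem IsSubexponentialWeight.tendsto_half_convolution (hw : IsSubexponentialWeight w C)
    {u v : ℕ → ℝ} {V : ℝ} (hu : Summable fun n => |u n|)
    (hv : Tendsto (fun n => v n / w n) atTop (𝓝 V)) (P : ℕ → ℕ → Prop) [∀ n, DecidablePred (P n)]
    (hP : ∀ n i, P n i → 2 * i ≤ n) (hP' : ∀ i, ∀ᶠ n in atTop, P n i) :
    Tendsto (fun n => (∑ i ∈ Finset.range (n + 1) with P n i, u i * v (n - i)) / w n) atTop
      (𝓝 ((∑' i, u i) * V)) := by
  obtain ⟨B, hB0, hB⟩ := exists_abs_le_mul_of_tendsto_div hw.pos hv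
  have hC := hw.const_nonneg
  -- Dominated convergence: 2i ≤ n gives `w (n - i) ≤ C * w n`. The predicate stays abstract because
  -- the midpoint belongs to only one of the two halves.
  have key : Tendsto (fun n => ∑' i, if P n i then u i * (v (n - i) / w n) else 0) atTop
      (𝓝 (∑' i, u i * V)) := by
    refine tendsto_tsum_of_dominated_convergence (bound := fun i => |u i| * (B * C))
      (hu.mul_right _) (fun i => ?_) (Eventually.of_forall fun n i => ?_)
    · have h1 := (hv.comp (tendsto_sub_atTop_nat i)).mul (hw.tendsto_sub_div i)
      rw [mul_one] at h1
      refine (h1.const_mul (u i)).congr' ?_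
      filter_upwards [hP' i] with n hn
      rw [if_pos hn]
      congr 1
      exact div_mul_div_cancel₀ (hw.pos (n - i)).ne'
    · split_ifs with h
      · have h1 : |v (n - i)| ≤ B * C * w n := by
          have := hw.le_mul (n - i) n (by have := hP n i h; omega)
          calc |v (n - i)| ≤ B * w (n - i) := hB _
            _ ≤ B * (C * w n) := by gcongr
            _ = _ := by ring
        rw [Real.norm_eq_abs, abs_mul, abs_div, abs_of_pos (hw.pos n)]
        gcongr
        exact (div_le_iff₀ (hw.pos n)).2 h1
      · rw [norm_zero]; positivity
  rw [tsum_mul_right] at key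
  refine key.congr fun n => ?_
  rw [tsum_eq_sum (s := Finset.range (n + 1)) fun i hi => if_neg fun h => hi
    (Finset.mem_range.2 (by have := hP n i h; omega)), Finset.sum_filter, Finset.sum_div]
  refine Finset.sum_congr rfl fun i _ => ?_
  split_ifs <;> ring

theorem sum_antidiagonal_eq_half_add_half (u v : ℕ → ℝ) (n : ℕ) :
    ∑ p ∈ Finset.HasAntidiagonal.antidiagonal n, u p.1 * v p.2 =
      ∑ i ∈ Finset.range (n + 1) with 2 * i ≤ n, u i * v (n - i) +
        ∑ j ∈ Finset.range (n + 1) with 2 * j < n, v j * u (n - j) := by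
  rw [Finset.Nat.sum_antidiagonal_eq_sum_range_succ (fun i j => u i * v j),
    ← Finset.sum_filter_add_sum_filter_not (Finset.range n.succ) (fun i => 2 * i ≤ n)]
  congr 1
  refine Finset.sum_nbij' (fun i => n - i) (fun i => n - i) ?_ ?_ ?_ ?_ ?_
  · intro i; simp only [Finset.mem_filter, Finset.mem_range]; omega
  · intro i; simp only [Finset.mem_filter, Finset.mem_range]; omega
  · intro i; simp only [Finset.mem_filter, Finset.mem_range]; omega
  · intro i; simp only [Finset.mem_filter, Finset.mem_range]; omega
  · intro i; simp only [Finset.mem_filter, Finset.mem_range]; intro hi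
    rw [show n - (n - i) = i by omega, mul_comm]

theorem IsSubexponentialWeight.tendsto_convolution (hw : IsSubexponentialWeight w C)
    {u v : ℕ → ℝ} {U V : ℝ} (hu : Tendsto (fun n => u n / w n) atTop (𝓝 U))
    (hv : Tendsto (fun n => v n / w n) atTop (𝓝 V)) :
    Tendsto (fun n => (∑ p ∈ Finset.HasAntidiagonal.antidiagonal n, u p.1 * v p.2) / w n) atTop
      (𝓝 ((∑' i, u i) * V + (∑' i, v i) * U)) := by
  simp_rw [sum_antidiagonal_eq_half_add_half, add_div]
  refine (hw.tendsto_half_convolution (hw.summable_abs hu) hv (fun n i => 2 * i ≤ n)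
    (fun n i h => h) fun i => eventually_ge_atTop _).add
    (hw.tendsto_half_convolution (hw.summable_abs hv) hu (fun n i => 2 * i < n)
    (fun n i h => h.le) fun i => eventually_gt_atTop _)

theorem IsSubexponentialWeight.abs_half_convolution_le (hw : IsSubexponentialWeight w C)
    {e y : ℕ → ℝ} (he : Summable fun n => |e n|) (heC : C * ∑' n, |e n| ≤ 1 / 2) {M : ℝ}
    (hM : 0 ≤ M) {n : ℕ} (hy : ∀ m ≤ n, n ≤ 2 * m → |y m| ≤ M * w m) :
    |∑ i ∈ Finset.range (n + 1) with 2 * i ≤ n, e i * y (n - i)| ≤ M / 2 * w n := by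
  have hC := hw.const_nonneg
  have hwn := (hw.pos n).le
  calc |∑ i ∈ Finset.range (n + 1) with 2 * i ≤ n, e i * y (n - i)|
      ≤ ∑ i ∈ Finset.range (n + 1) with 2 * i ≤ n, |e i * y (n - i)| :=
        Finset.abs_sum_le_sum_abs _ _
    _ ≤ ∑ i ∈ Finset.range (n + 1) with 2 * i ≤ n, |e i| * (M * (C * w n)) := by
        refine Finset.sum_le_sum fun i hi => ?_
        have hi' := (Finset.mem_filter.1 hi).2
        rw [abs_mul]
        have h1 := hy (n - i) (by omega) (by omega)
        have h2 := hw.le_mul (n - i) n (by omega)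
        gcongr
        exact h1.trans (by gcongr)
    _ = (∑ i ∈ Finset.range (n + 1) with 2 * i ≤ n, |e i|) * (M * (C * w n)) :=
        (Finset.sum_mul ..).symm
    _ ≤ (∑' i, |e i|) * (M * (C * w n)) := by
        gcongr
        exact he.sum_le_tsum _ fun i _ => abs_nonneg _
    _ = (C * ∑' i, |e i|) * (M * w n) := by ring
    _ ≤ 1 / 2 * (M * w n) := by gcongr
    _ = _ := by ring

/-- The half-convolution sees `y` only on [n/2, n], so a bound `M` for |y|/w there becomes |δ| + M/2
at `n`. This yields boundedness first, then geometric improvement along the tail. -/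
theorem IsSubexponentialWeight.tendsto_zero_of_contraction (hw : IsSubexponentialWeight w C)
    {e y δ : ℕ → ℝ} (he : Summable fun n => |e n|) (heC : C * ∑' n, |e n| ≤ 1 / 2)
    (hδ : Tendsto δ atTop (𝓝 0))
    (hy : ∀ n, y n = δ n * w n + ∑ i ∈ Finset.range (n + 1) with 2 * i ≤ n, e i * y (n - i)) :
    Tendsto (fun n => y n / w n) atTop (𝓝 0) := by
  obtain ⟨B, hB⟩ := hδ.abs.bddAbove_range
  have hB' : ∀ n, |δ n| ≤ B := fun n => hB ⟨n, rfl⟩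
  have hB0 : 0 ≤ B := (abs_nonneg _).trans (hB' 0)
  have hstep : ∀ n M, 0 ≤ M → (∀ m ≤ n, n ≤ 2 * m → |y m| ≤ M * w m) →
      |y n| ≤ (|δ n| + M / 2) * w n := by
    intro n M hM h
    have h1 := hw.abs_half_convolution_le he heC hM h
    rw [hy n]
    refine (abs_add_le _ _).trans ?_
    rw [abs_mul, abs_of_pos (hw.pos n)]
    linarith
  -- At a maximiser of |y|/w on [0, n], the maximum M satisfies M ≤ B + M/2.
  have hbdd : ∀ n, |y n| ≤ 2 * B * w n := by
    intro n
    obtain ⟨m, hm, hmax⟩ := Finset.exists_max_image (Finset.range (n + 1))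
      (fun m => |y m| / w m) ⟨0, by simp⟩
    have hM0 : 0 ≤ |y m| / w m := div_nonneg (abs_nonneg _) (hw.pos m).le
    have h1 := hstep m _ hM0 fun j hj _ => (div_le_iff₀ (hw.pos j)).1
      (hmax j (Finset.mem_range.2 (by have := Finset.mem_range.1 hm; omega)))
    rw [← div_le_iff₀ (hw.pos m)] at h1
    have h2 := hmax n (by simp)
    rw [← div_le_iff₀ (hw.pos n)]
    linarith [hB' m]
  -- The rate 3/4 is 1/2 from the contraction plus 1/4 left for δ; the added 1 keeps the bound
  -- positive even if B = 0.
  have hiter : ∀ i : ℕ, ∀ᶠ n in atTop, |y n| ≤ (3 / 4 : ℝ) ^ i * (2 * B + 1) * w n := by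
    intro i
    induction i with
    | zero =>
      refine Eventually.of_forall fun n => (hbdd n).trans ?_
      have := hw.pos n
      rw [pow_zero, one_mul]
      gcongr
      linarith
    | succ i ih =>
      obtain ⟨N, hN⟩ := eventually_atTop.1 ih
      have hpos : 0 < (3 / 4 : ℝ) ^ i * (2 * B + 1) := by positivity
      filter_upwards [eventually_ge_atTop (2 * N),
        (hδ.abs.eventually (ge_mem_nhds (show |(0 : ℝ)| < (3 / 4 : ℝ) ^ i * (2 * B + 1) / 4 by
          rw [abs_zero]; positivity)))] with n hn hn'
      refine (hstep n _ hpos.le fun m _ hm => hN m (by omega)).trans ?_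
      have := hw.pos n
      gcongr
      rw [pow_succ]
      linarith
  rw [Metric.tendsto_nhds]
  intro ε hε
  have hgeo : Tendsto (fun i : ℕ => (3 / 4 : ℝ) ^ i * (2 * B + 1)) atTop (𝓝 0) := by
    simpa using (tendsto_pow_atTop_nhds_zero_of_lt_one (by norm_num : (0 : ℝ) ≤ 3 / 4)
      (by norm_num)).mul_const (2 * B + 1)
  obtain ⟨i, hi⟩ := (hgeo.eventually (gt_mem_nhds hε)).exists
  filter_upwards [hiter i] with n hn
  rw [dist_zero_right, Real.norm_eq_abs, abs_div, abs_of_pos (hw.pos n)]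
  exact ((div_le_iff₀ (hw.pos n)).2 hn).trans_lt hi

end Convolution

/-! ### The renewal equation in the algebra of power series. -/

section PowerSeries

open PowerSeries

theorem PowerSeries.summable_abs_coeff_mul {A B : ℝ⟦X⟧} (hA : Summable fun n => |coeff n A|)
    (hB : Summable fun n => |coeff n B|) : Summable fun n => |coeff n (A * B)| := by
  simp_rw [coeff_mul]
  exact summable_norm_sum_mul_antidiagonal_of_summable_norm (f := fun n => coeff n A)
    (g := fun n => coeff n B) hA hB

theorem PowerSeries.tsum_coeff_mul {A B : ℝ⟦X⟧} (hA : Summable fun n => |coeff n A|)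
    (hB : Summable fun n => |coeff n B|) :
    ∑' n, coeff n (A * B) = (∑' n, coeff n A) * ∑' n, coeff n B := by
  simp_rw [coeff_mul]
  exact (tsum_mul_tsum_eq_tsum_sum_antidiagonal_of_summable_norm (f := fun n => coeff n A)
    (g := fun n => coeff n B) hA hB).symm

theorem PowerSeries.tsum_abs_coeff_mul_le {A B : ℝ⟦X⟧} (hA : Summable fun n => |coeff n A|)
    (hB : Summable fun n => |coeff n B|) :
    ∑' n, |coeff n (A * B)| ≤ (∑' n, |coeff n A|) * ∑' n, |coeff n B| := by
  have hA' : Summable fun n => ‖|coeff n A|‖ := by simpa using hA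
  have hB' : Summable fun n => ‖|coeff n B|‖ := by simpa using hB
  rw [tsum_mul_tsum_eq_tsum_sum_antidiagonal_of_summable_norm hA' hB']
  refine (summable_abs_coeff_mul hA hB).tsum_le_tsum (fun n => ?_)
    (summable_norm_sum_mul_antidiagonal_of_summable_norm hA' hB').of_norm
  rw [coeff_mul]
  refine (Finset.abs_sum_le_sum_abs _ _).trans (le_of_eq ?_)
  simp_rw [abs_mul]

theorem exists_tsum_tail_le {r : ℕ → ℝ} (hr : Summable fun n => |r n|) {ε : ℝ} (hε : 0 < ε) :
    ∃ N, ∑' n, |r n - if n < N then r n else 0| ≤ ε := by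
  have h : Tendsto (fun N => ∑' n, |r n - if n < N then r n else 0|) atTop
      (𝓝 (∑' _ : ℕ, (0 : ℝ))) := by
    refine tendsto_tsum_of_dominated_convergence hr (fun n => ?_)
      (Eventually.of_forall fun N n => ?_)
    · refine tendsto_const_nhds.congr' ?_
      filter_upwards [eventually_gt_atTop n] with N hN
      simp [hN]
    · split_ifs <;> simp
  rw [tsum_zero] at h
  exact (h.eventually (ge_mem_nhds hε)).exists

/-- Asymptotics of a summable solution of a renewal equation with subexponential kernel. -/
theorem IsSubexponentialWeight.tendsto_renewal {w : ℕ → ℝ} {C : ℝ}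
    (hw : IsSubexponentialWeight w C) {q r : ℕ → ℝ}
    (hq : Tendsto (fun n => q n / w n) atTop (𝓝 1)) (hr0 : r 0 = 1)
    (hr : ∀ n, r (n + 1) = ∑ p ∈ Finset.HasAntidiagonal.antidiagonal n, q p.1 * r p.2)
    (hsum : Summable fun n => |r n|) :
    Tendsto (fun n => r n / w n) atTop (𝓝 ((∑' n, r n) ^ 2)) := by
  set D : ℝ⟦X⟧ := 1 - X * PowerSeries.mk q with hD
  have hRD : PowerSeries.mk r * D = 1 := by
    have h1 : PowerSeries.mk r = 1 + X * (PowerSeries.mk q * PowerSeries.mk r) := by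
      ext n
      cases n with
      | zero => simp [hr0]
      | succ n =>
        rw [map_add, coeff_succ_X_mul, coeff_mul]
        simp [hr, coeff_one]
    calc PowerSeries.mk r * D = PowerSeries.mk r - X * (PowerSeries.mk q * PowerSeries.mk r) := by rw [hD]; ring
      _ = 1 := sub_eq_iff_eq_add.2 h1
  have hDlim : Tendsto (fun n => coeff n D / w n) atTop (𝓝 (-1)) := by
    rw [← tendsto_add_atTop_iff_nat 1]
    have h1 := (hq.mul (hw.tendsto_succ_div.inv₀ one_ne_zero)).neg
    rw [inv_one, mul_one] at h1
    refine h1.congr fun n => ?_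
    have h2 : coeff (n + 1) D = -q n := by simp [hD, coeff_succ_X_mul, coeff_one]
    rw [h2, inv_div, div_mul_div_cancel₀ (hw.pos n).ne', neg_div]
  have hDsum := hw.summable_abs hDlim
  have hC := hw.const_nonneg
  set T := ∑' n, |coeff n D| with hT
  have hT0 : 0 ≤ T := tsum_nonneg fun n => abs_nonneg _
  -- The tail is chosen so that C‖e‖₁ ≤ CT/(2(CT + 1)) ≤ 1/2; the added 1 avoids dividing by zero.
  obtain ⟨N, hN⟩ := exists_tsum_tail_le hsum (show 0 < 1 / (2 * (C * T + 1)) by positivity)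
  set t : ℕ → ℝ := fun n => if n < N then r n else 0 with ht
  have htz : ∀ n, N ≤ n → t n = 0 := fun n hn => by simp [ht, hn.not_gt]
  set e : ℝ⟦X⟧ := 1 - PowerSeries.mk t * D with he
  have he' : e = PowerSeries.mk (fun n => r n - t n) * D := by
    have : (PowerSeries.mk fun n => r n - t n) = PowerSeries.mk r - PowerSeries.mk t := by ext; simp
    rw [this, sub_mul, hRD]
  have htlim : Tendsto (fun n => t n / w n) atTop (𝓝 0) := by
    refine tendsto_const_nhds.congr' ?_
    filter_upwards [eventually_ge_atTop N] with n hn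
    rw [htz n hn, zero_div]
  have htsum := hw.summable_abs htlim
  have hrt : Summable fun n => |r n - t n| :=
    Summable.of_nonneg_of_le (fun n => abs_nonneg _) (fun n => abs_sub _ _) (hsum.add htsum)
  have helim : Tendsto (fun n => coeff n e / w n) atTop (𝓝 (∑' n, t n)) := by
    have h1 := (hw.tendsto_convolution htlim hDlim).neg
    rw [mul_zero, add_zero, mul_neg_one, neg_neg] at h1
    refine h1.congr' ?_
    filter_upwards [eventually_gt_atTop 0] with n hn
    simp [he, coeff_mul, coeff_one, hn.ne', neg_div]
  have hesum := hw.summable_abs helim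
  have heC : C * ∑' n, |coeff n e| ≤ 1 / 2 := by
    have h1 : ∑' n, |coeff n e| ≤ 1 / (2 * (C * T + 1)) * T := by
      rw [he']
      refine (tsum_abs_coeff_mul_le (by simpa using hrt) hDsum).trans ?_
      simp only [coeff_mk]
      gcongr
    calc C * ∑' n, |coeff n e| ≤ C * (1 / (2 * (C * T + 1)) * T) := by gcongr
      _ = (C * T) / (C * T + 1) * (1 / 2) := by field_simp
      _ ≤ 1 * (1 / 2) := by
        gcongr
        exact (div_le_one (by positivity)).2 (by linarith)
      _ = _ := by ring
  have hRe : PowerSeries.mk r = PowerSeries.mk t + e * PowerSeries.mk r := by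
    rw [he, sub_mul, one_mul, mul_assoc, mul_comm D, hRD]; ring
  set R := ∑' n, r n with hR
  -- Summing the coefficients of eR = R - t gives the identity that singles out R² as the limit.
  have hRE : (∑' n, coeff n e) * R = R - ∑' n, t n := by
    have h1 := tsum_coeff_mul hesum (show Summable fun n => |coeff n (PowerSeries.mk r)| by simpa using hsum)
    have h2 : e * PowerSeries.mk r = PowerSeries.mk r - PowerSeries.mk t := by rw [eq_sub_iff_add_eq, add_comm]; exact hRe.symm
    rw [h2] at h1
    simp only [map_sub, coeff_mk] at h1
    rw [(hsum.of_abs).tsum_sub htsum.of_abs] at h1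
    exact h1.symm
  have hone : Tendsto (fun n => w n / w n) atTop (𝓝 1) :=
    tendsto_const_nhds.congr fun n => (div_self (hw.pos n).ne').symm
  have hA := hw.tendsto_half_convolution hesum hone (fun n i => 2 * i ≤ n)
    (fun n i h => h) fun i => eventually_ge_atTop _
  have hB := hw.tendsto_half_convolution hsum helim (fun n i => 2 * i < n)
    (fun n i h => h.le) fun i => eventually_gt_atTop _
  -- The forcing term for y = r - R²w. With E = ∑ e and T = ∑ t its limit is R(RE + T - R) = 0.
  have hδ := (htlim.add ((hA.const_mul (R ^ 2)).add hB)).sub_const (R ^ 2)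
  rw [show 0 + (R ^ 2 * ((∑' n, coeff n e) * 1) + R * ∑' n, t n) - R ^ 2 = 0 by
    linear_combination R * hRE] at hδ
  have hfin := hw.tendsto_zero_of_contraction (y := fun n => r n - R ^ 2 * w n) hesum heC hδ ?_
  · have h1 := hfin.add_const (R ^ 2)
    rw [zero_add] at h1
    refine h1.congr fun n => ?_
    rw [sub_div, mul_div_cancel_right₀ _ (hw.pos n).ne', sub_add_cancel]
  · intro n
    have h1 : r n = t n + ∑ p ∈ Finset.HasAntidiagonal.antidiagonal n, coeff p.1 e * r p.2 := by
      have := congrArg (coeff n) hRe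
      simpa [coeff_mul] using this
    rw [sum_antidiagonal_eq_half_add_half (fun n => coeff n e)] at h1
    have hwn := (hw.pos n).ne'
    have h2 : ∑ i ∈ Finset.range (n + 1) with 2 * i ≤ n, coeff i e * (r (n - i) - R ^ 2 * w (n - i))
        = ∑ i ∈ Finset.range (n + 1) with 2 * i ≤ n, coeff i e * r (n - i) -
          R ^ 2 * ∑ i ∈ Finset.range (n + 1) with 2 * i ≤ n, coeff i e * w (n - i) := by
      rw [Finset.mul_sum, ← Finset.sum_sub_distrib]
      exact Finset.sum_congr rfl fun i _ => by ring
    simp only [h2]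
    field_simp
    linear_combination h1

end PowerSeries

/-! ### Moving averages in normed and Hilbert spaces. -/

section MovingAverage

variable {E : Type*} [NormedAddCommGroup E]

/-- The two-sided stationary moving average `∑_{m ≥ 0} r m x (n - m)`. -/
noncomputable def movingAverage [NormedSpace ℝ E] (r : ℕ → ℝ) (x : ℤ → E) (n : ℤ) : E :=
  ∑' m : ℕ, r m • x (n - (m : ℤ))

theorem hasSum_movingAverage [NormedSpace ℝ E] [CompleteSpace E] {r : ℕ → ℝ} {x : ℤ → E} {s : ℝ}
    (hr : Summable fun n => |r n|) (hx : ∀ n, ‖x n‖ ≤ s) (n : ℤ) :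
    HasSum (fun m : ℕ => r m • x (n - (m : ℤ))) (movingAverage r x n) := by
  refine (Summable.of_norm_bounded (hr.mul_right s) fun m => ?_).hasSum
  rw [norm_smul, Real.norm_eq_abs]
  gcongr
  exact hx _

/-- A moving average with renewal coefficients satisfies the renewal recurrence. -/
theorem hasSum_smul_movingAverage [NormedSpace ℝ E] [CompleteSpace E] {q r : ℕ → ℝ} {x : ℤ → E}
    {s : ℝ} (hq : Summable fun n => |q n|) (hr : Summable fun n => |r n|) (hr0 : r 0 = 1)
    (hrec : ∀ n, r (n + 1) = ∑ p ∈ Finset.HasAntidiagonal.antidiagonal n, q p.1 * r p.2)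
    (hx : ∀ n, ‖x n‖ ≤ s) (n : ℤ) :
    HasSum (fun j : ℕ => q j • movingAverage r x (n - (j : ℤ)))
      (movingAverage r x (n + 1) - x (n + 1)) := by
  -- The absolutely convergent double series is summed in two ways: rows give the left side,
  -- antidiagonals give the moving average at n + 1 without its term of index 0.
  have hF : Summable fun p : ℕ × ℕ => (q p.1 * r p.2) • x (n - (p.1 : ℤ) - (p.2 : ℤ)) := by
    refine Summable.of_norm_bounded ((hq.mul_of_nonneg hr (fun _ => abs_nonneg _)
      fun _ => abs_nonneg _).mul_right s) fun p => ?_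
    rw [norm_smul, Real.norm_eq_abs, abs_mul]
    gcongr
    exact hx _
  have h1 : HasSum (fun j : ℕ => q j • movingAverage r x (n - (j : ℤ)))
      (∑' p : ℕ × ℕ, (q p.1 * r p.2) • x (n - (p.1 : ℤ) - (p.2 : ℤ))) := by
    refine hF.hasSum.prod_fiberwise fun j => ?_
    simp_rw [mul_smul]
    exact (hasSum_movingAverage hr hx _).const_smul (q j)
  have h2 := (Finset.HasAntidiagonal.sigmaAntidiagonalEquivProd (A := ℕ)).hasSum_iff.2 hF.hasSum
  have h3 : HasSum (fun N : ℕ => r (N + 1) • x (n + 1 - ((N + 1 : ℕ) : ℤ)))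
      (∑' p : ℕ × ℕ, (q p.1 * r p.2) • x (n - (p.1 : ℤ) - (p.2 : ℤ))) := by
    refine h2.sigma fun N => ?_
    have h4 : r (N + 1) • x (n + 1 - ((N + 1 : ℕ) : ℤ)) =
        ∑ p : Finset.HasAntidiagonal.antidiagonal N,
          (q p.1.1 * r p.1.2) • x (n - (p.1.1 : ℤ) - (p.1.2 : ℤ)) := by
      rw [Finset.sum_coe_sort (Finset.HasAntidiagonal.antidiagonal N)
        (fun p => (q p.1 * r p.2) • x (n - (p.1 : ℤ) - (p.2 : ℤ))), hrec, Finset.sum_smul]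
      refine Finset.sum_congr rfl fun p hp => ?_
      have := Finset.HasAntidiagonal.mem_antidiagonal.1 hp
      congr 2
      push_cast [← this]
      ring
    rw [h4]
    exact hasSum_fintype _
  have h5 := (hasSum_nat_add_iff' 1).2 (hasSum_movingAverage hr hx (n + 1))
  simp only [Finset.sum_range_one, hr0, one_smul, Nat.cast_zero, sub_zero] at h5
  rwa [← h3.unique h5]

/-- Continuity of the inner product allows termwise expansion, and orthogonality keeps only pairs
with the same time index. -/
theorem inner_movingAverage [InnerProductSpace ℝ E] [CompleteSpace E] {r : ℕ → ℝ} {x : ℤ → E}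
    {s v : ℝ} (hr : Summable fun n => |r n|) (hx : ∀ n, ‖x n‖ ≤ s)
    (hxx : ∀ i j, inner ℝ (x i) (x j) = if i = j then v else 0) (n : ℤ) (h : ℕ) :
    inner ℝ (movingAverage r x n) (movingAverage r x (n + h)) =
      v * ∑' j : ℕ, r j * r (j + h) := by
  have h1 : ∀ i : ℕ, inner ℝ (x (n - i)) (movingAverage r x (n + h)) = r (i + h) * v := by
    intro i
    have h2 := (hasSum_movingAverage hr hx (n + h)).mapL (innerSL ℝ (x (n - i)))
    refine h2.unique ?_
    have h3 := hasSum_single (f := fun m : ℕ =>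
      innerSL ℝ (x (n - i)) (r m • x (n + h - (m : ℤ)))) (i + h) fun m hm => by
        rw [innerSL_apply_apply, inner_smul_right, hxx, if_neg (by omega), mul_zero]
    rwa [innerSL_apply_apply, inner_smul_right, hxx, if_pos (by push_cast; ring)] at h3
  have h4 := (hasSum_movingAverage hr hx n).mapL (innerSL ℝ (movingAverage r x (n + h)))
  simp only [innerSL_apply_apply, inner_smul_right] at h4
  rw [real_inner_comm, ← h4.tsum_eq, ← tsum_mul_left]
  refine tsum_congr fun i => ?_
  rw [real_inner_comm, h1]
  ring

end MovingAverage

/-! ### The stationary solution in L² and its uniqueness. -/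

section LinearProcess

variable {Ω : Type*} [MeasurableSpace Ω] {μ : Measure Ω}

theorem Lp.coeFn_sum_smul (s : Finset ℕ) (c : ℕ → ℝ) (f : ℕ → Lp ℝ 2 μ) (g : ℕ → Ω → ℝ)
    (hfg : ∀ j ∈ s, f j =ᵐ[μ] g j) :
    (∑ j ∈ s, c j • f j : Lp ℝ 2 μ) =ᵐ[μ] fun ω => ∑ j ∈ s, c j * g j ω := by
  classical
  induction s using Finset.induction_on with
  | empty =>
    filter_upwards [Lp.coeFn_zero ℝ 2 μ] with ω hω
    simpa using hω
  | insert i s hi ih =>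
    rw [Finset.sum_insert hi]
    filter_upwards [Lp.coeFn_add (c i • f i) (∑ j ∈ s, c j • f j), Lp.coeFn_smul (c i) (f i),
      hfg i (Finset.mem_insert_self _ _), ih fun j hj => hfg j (Finset.mem_insert_of_mem hj)]
      with ω h1 h2 h3 h4
    rw [h1, Pi.add_apply, h2, h4, Pi.smul_apply, h3, Finset.sum_insert hi, smul_eq_mul]

/-- The noise as a sequence in the Hilbert space of square integrable random variables. -/
noncomputable def IsIIDNoise.toLp {ξ : ℤ → Ω → ℝ} {σ : ℝ} (hξ : IsIIDNoise μ ξ σ) (n : ℤ) :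
    Lp ℝ 2 μ :=
  (hξ.memLp n).toLp (ξ n)

variable {ξ : ℤ → Ω → ℝ} {σ : ℝ}

theorem IsIIDNoise.coeFn_toLp (hξ : IsIIDNoise μ ξ σ) (n : ℤ) : hξ.toLp n =ᵐ[μ] ξ n :=
  (hξ.memLp n).coeFn_toLp

theorem IsIIDNoise.inner_toLp (hξ : IsIIDNoise μ ξ σ) (i j : ℤ) :
    inner ℝ (hξ.toLp i) (hξ.toLp j) = if i = j then σ ^ 2 else 0 := by
  have h1 : inner ℝ (hξ.toLp i) (hξ.toLp j) = ∫ ω, ξ i ω * ξ j ω ∂μ := by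
    rw [L2.inner_def]
    refine integral_congr_ae ?_
    filter_upwards [hξ.coeFn_toLp i, hξ.coeFn_toLp j] with ω h1 h2
    rw [h1, h2, Real.inner_apply]
  rw [h1]
  split_ifs with h
  · subst h
    simp_rw [← pow_two]
    exact hξ.second_moment i
  · rw [(hξ.indep.indepFun h).integral_fun_mul_eq_mul_integral
      (hξ.measurable i).aestronglyMeasurable (hξ.measurable j).aestronglyMeasurable, hξ.mean,
      zero_mul]

/-- The stationary moving average of the noise, as a square integrable random variable. -/
noncomputable abbrev IsIIDNoise.linearProcess (hξ : IsIIDNoise μ ξ σ) (r : ℕ → ℝ) (n : ℤ) :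
    Lp ℝ 2 μ :=
  movingAverage r hξ.toLp n

theorem IsIIDNoise.norm_toLp (hξ : IsIIDNoise μ ξ σ) (n : ℤ) : ‖hξ.toLp n‖ = |σ| := by
  rw [norm_eq_sqrt_real_inner, hξ.inner_toLp, if_pos rfl, Real.sqrt_sq_eq_abs]

theorem IsIIDNoise.integral_linearProcess [IsProbabilityMeasure μ] (hξ : IsIIDNoise μ ξ σ)
    {r : ℕ → ℝ} (hr : Summable fun n => |r n|) (n : ℤ) :
    ∫ ω, hξ.linearProcess r n ω ∂μ = 0 := by
  -- The mean is the inner product with the constant 1, hence continuous on L² and computable term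
  -- by term.
  have hone : ∀ f : Lp ℝ 2 μ, innerSL ℝ (indicatorConstLp 2 MeasurableSet.univ
      (measure_ne_top μ _) (1 : ℝ)) f = ∫ ω, f ω ∂μ := fun f => by
    rw [innerSL_apply_apply, L2.inner_indicatorConstLp_one, setIntegral_univ]
  have h1 := (hasSum_movingAverage hr (fun n => (hξ.norm_toLp n).le) n).mapL
    (innerSL ℝ (indicatorConstLp 2 MeasurableSet.univ (measure_ne_top μ _) (1 : ℝ)))
  rw [hone] at h1
  refine h1.unique ?_
  have h2 : ∀ m : ℕ, innerSL ℝ (indicatorConstLp 2 MeasurableSet.univ (measure_ne_top μ _) (1 : ℝ))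
      (r m • hξ.toLp (n - (m : ℤ))) = 0 := by
    intro m
    rw [map_smul, hone, integral_congr_ae (hξ.coeFn_toLp _), hξ.mean, smul_zero]
  simp_rw [h2]
  exact hasSum_zero

theorem IsIIDNoise.tendstoInMeasure_linearProcess (hξ : IsIIDNoise μ ξ σ)
    {r : ℕ → ℝ} (hr : Summable fun n => |r n|) (n : ℤ) :
    TendstoInMeasure μ
      (fun (M : ℕ) (ω : Ω) => ∑ m ∈ Finset.range M, r m * ξ (n - (m : ℤ)) ω) atTop
      (hξ.linearProcess r n) :=
  (tendstoInMeasure_of_tendsto_Lp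
    (hasSum_movingAverage hr (fun n => (hξ.norm_toLp n).le) n).tendsto_sum_nat).congr
    (fun _ => Lp.coeFn_sum_smul _ _ _ _ fun _ _ => hξ.coeFn_toLp _) EventuallyEq.rfl

/-- Agreement of `X` with the moving average is asked only up to time `n`, so that the same
statement serves existence and the induction step of uniqueness. -/
theorem IsIIDNoise.tendstoInMeasure_recurrence (hξ : IsIIDNoise μ ξ σ)
    {a : ℝ} {k q r : ℕ → ℝ} (hq0 : q 0 = 1 + a) (hqk : ∀ n, 1 ≤ n → q n = k n)
    (hq : Summable fun n => |q n|) (hr : Summable fun n => |r n|) (hr0 : r 0 = 1)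
    (hrec : ∀ n, r (n + 1) = ∑ p ∈ Finset.HasAntidiagonal.antidiagonal n, q p.1 * r p.2)
    {X : ℤ → Ω → ℝ} (n : ℤ) (hX : ∀ m ≤ n, X m =ᵐ[μ] hξ.linearProcess r m) :
    TendstoInMeasure μ
      (fun (M : ℕ) (ω : Ω) => ∑ j ∈ Finset.Icc 1 M, k j * X (n - (j : ℤ)) ω) atTop
      (fun ω => hξ.linearProcess r (n + 1) ω - X n ω - a * X n ω - ξ (n + 1) ω) := by
  set Y := hξ.linearProcess r
  have h1 : Tendsto (fun N => ∑ j ∈ Finset.range N, q j • Y (n - (j : ℤ))) atTop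
      (𝓝 (Y (n + 1) - hξ.toLp (n + 1))) :=
    (hasSum_smul_movingAverage hq hr hr0 hrec (fun n => (hξ.norm_toLp n).le) n).tendsto_sum_nat
  have h2 := ((tendsto_add_atTop_iff_nat 1).2 h1).sub_const ((1 + a) • Y n)
  have h3 : ∀ M : ℕ, ∑ j ∈ Finset.range (M + 1), q j • Y (n - (j : ℤ)) - (1 + a) • Y n =
      ∑ j ∈ Finset.Icc 1 M, k j • Y (n - (j : ℤ)) := by
    intro M
    have : Finset.range (M + 1) = insert 0 (Finset.Icc 1 M) := by ext; simp; omega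
    rw [this, Finset.sum_insert (by simp), hq0, Nat.cast_zero, sub_zero, add_sub_cancel_left]
    exact Finset.sum_congr rfl fun j hj => by rw [hqk j (Finset.mem_Icc.1 hj).1]
  simp_rw [h3] at h2
  refine (tendstoInMeasure_of_tendsto_Lp h2).congr
    (fun M => Lp.coeFn_sum_smul _ _ _ _ fun j _ => (hX _ (by omega)).symm) ?_
  filter_upwards [Lp.coeFn_sub (Y (n + 1) - hξ.toLp (n + 1)) ((1 + a) • Y n),
    Lp.coeFn_sub (Y (n + 1)) (hξ.toLp (n + 1)), Lp.coeFn_smul (1 + a) (Y n),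
    hξ.coeFn_toLp (n + 1), hX n le_rfl] with ω h4 h5 h6 h7 h8
  rw [h4, Pi.sub_apply, h5, h6, Pi.sub_apply, Pi.smul_apply, h7, h8, smul_eq_mul]
  ring

/-- The moving average of the noise is a solution of the Volterra equation. -/
theorem IsIIDNoise.isVolterraProcess_linearProcess (hξ : IsIIDNoise μ ξ σ)
    {a : ℝ} {k q r : ℕ → ℝ} (hq0 : q 0 = 1 + a) (hqk : ∀ n, 1 ≤ n → q n = k n)
    (hq : Summable fun n => |q n|) (hr : Summable fun n => |r n|) (hr0 : r 0 = 1)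
    (hrec : ∀ n, r (n + 1) = ∑ p ∈ Finset.HasAntidiagonal.antidiagonal n, q p.1 * r p.2) :
    IsVolterraProcess μ a k r ξ fun n => hξ.linearProcess r n where
  aemeasurable _ := (Lp.aestronglyMeasurable _).aemeasurable
  recurrence n _ := hξ.tendstoInMeasure_recurrence (X := fun n => hξ.linearProcess r n)
    hq0 hqk hq hr hr0 hrec n fun _ _ => EventuallyEq.rfl
  past n _ := hξ.tendstoInMeasure_linearProcess hr n

/-- The solution of the Volterra equation is almost surely unique. -/
theorem IsVolterraProcess.ae_eq_linearProcess (hξ : IsIIDNoise μ ξ σ)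
    {a : ℝ} {k q r : ℕ → ℝ} (hq0 : q 0 = 1 + a) (hqk : ∀ n, 1 ≤ n → q n = k n)
    (hq : Summable fun n => |q n|) (hr : Summable fun n => |r n|) (hr0 : r 0 = 1)
    (hrec : ∀ n, r (n + 1) = ∑ p ∈ Finset.HasAntidiagonal.antidiagonal n, q p.1 * r p.2)
    {X : ℤ → Ω → ℝ} (hX : IsVolterraProcess μ a k r ξ X) (n : ℤ) :
    X n =ᵐ[μ] hξ.linearProcess r n := by
  -- The recurrence involves the whole past, so the induction carries all times up to `N`; limits in
  -- measure are almost surely unique.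
  have key : ∀ N : ℕ, ∀ m : ℤ, m ≤ N → X m =ᵐ[μ] hξ.linearProcess r m := by
    intro N
    induction N with
    | zero =>
      intro m hm
      exact tendstoInMeasure_ae_unique (hX.past m (by simpa using hm))
        (hξ.tendstoInMeasure_linearProcess hr m)
    | succ N ih =>
      intro m hm
      rcases (show m ≤ (N : ℤ) ∨ m = N + 1 by push_cast at hm; omega) with h | rfl
      · exact ih m h
      · have h1 := tendstoInMeasure_ae_unique (hX.recurrence N (by positivity))
          (hξ.tendstoInMeasure_recurrence hq0 hqk hq hr hr0 hrec N ih)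
        filter_upwards [h1] with ω hω
        linarith
  exact key n.toNat n (Int.self_le_toNat n)

theorem IsIIDNoise.isAutocovariance_of_ae_eq_linearProcess [IsProbabilityMeasure μ]
    (hξ : IsIIDNoise μ ξ σ) {r : ℕ → ℝ} (hr : Summable fun n => |r n|) {X : ℤ → Ω → ℝ}
    (hX : ∀ n, X n =ᵐ[μ] hξ.linearProcess r n) :
    IsAutocovariance μ X fun h => σ ^ 2 * ∑' j : ℕ, r j * r (j + h) := by
  have hmem : ∀ n, MemLp (X n) 2 μ := fun n => (memLp_congr_ae (hX n)).2 (Lp.memLp _)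
  refine ⟨hmem, fun n h => ?_⟩
  rw [covariance_eq_sub (hmem _) (hmem _), integral_congr_ae (hX n),
    hξ.integral_linearProcess hr, zero_mul, sub_zero,
    ← inner_movingAverage hr (fun n => (hξ.norm_toLp n).le) hξ.inner_toLp n h, L2.inner_def]
  refine integral_congr_ae ?_
  filter_upwards [hX n, hX (n + h)] with ω h1 h2
  rw [Pi.mul_apply, h1, h2, Real.inner_apply]

end LinearProcess

/-! ### Autocovariance asymptotics, summability and conclusion. -/

/-- Dominated convergence in `j`: `r (j + h) / w h` tends to `V` for fixed `j`, and `w (j + h) ≤ C *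
w h` gives the majorant. -/
theorem IsSubexponentialWeight.tendsto_tsum_mul_shift {w : ℕ → ℝ} {C : ℝ}
    (hw : IsSubexponentialWeight w C) {r : ℕ → ℝ} {V : ℝ}
    (hr : Tendsto (fun n => r n / w n) atTop (𝓝 V)) :
    Tendsto (fun h => (∑' j, r j * r (j + h)) / w h) atTop (𝓝 ((∑' j, r j) * V)) := by
  obtain ⟨B, hB0, hB⟩ := exists_abs_le_mul_of_tendsto_div hw.pos hr
  have hC := hw.const_nonneg
  simp_rw [← tsum_div_const, ← tsum_mul_right]
  refine tendsto_tsum_of_dominated_convergence (bound := fun j => |r j| * (B * C))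
    ((hw.summable_abs hr).mul_right _) (fun j => ?_) (Eventually.of_forall fun h j => ?_)
  · have h1 := (((tendsto_add_atTop_iff_nat j).2 hr).mul (hw.tendsto_add_div j)).const_mul (r j)
    rw [mul_one] at h1
    refine h1.congr fun h => ?_
    rw [div_mul_div_cancel₀ (hw.pos (h + j)).ne', mul_div_assoc, add_comm h]
  · have h1 : |r (j + h)| ≤ B * C * w h := by
      calc |r (j + h)| ≤ B * w (j + h) := hB _
        _ ≤ B * (C * w h) := by gcongr; exact hw.le_mul _ _ (by omega)
        _ = _ := by ring
    rw [Real.norm_eq_abs, mul_div_assoc, abs_mul, abs_div, abs_of_pos (hw.pos h)]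
    gcongr
    exact (div_le_iff₀ (hw.pos h)).2 h1

theorem IsFundamentalSolution.renewal {a : ℝ} {k q r : ℕ → ℝ} (hr : IsFundamentalSolution a k r)
    (hq0 : q 0 = 1 + a) (hqk : ∀ n, 1 ≤ n → q n = k n) (n : ℕ) :
    r (n + 1) = ∑ p ∈ Finset.HasAntidiagonal.antidiagonal n, q p.1 * r p.2 := by
  have : Finset.range (n + 1) = insert 0 (Finset.Icc 1 n) := by ext; simp; omega
  rw [Finset.Nat.sum_antidiagonal_eq_sum_range_succ (fun i j => q i * r j), Nat.succ_eq_add_one,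
    this, Finset.sum_insert (by simp), hq0, tsub_zero,
    Finset.sum_congr rfl fun j hj => by rw [hqk j (Finset.mem_Icc.1 hj).1]]
  linear_combination hr.2 n

/-- Here `r` is nonnegative and its partial sums satisfy S(M+1) ≤ 1 + (∑ q) S(M), hence stay below
1/(1 - ∑ q). This settles a ≥ -1, where `q 0 = 1 + a` is nonnegative. -/
theorem summable_of_renewal_of_nonneg {q r : ℕ → ℝ} (hq : ∀ n, 0 ≤ q n) (hqs : Summable q)
    (hq1 : ∑' n, q n < 1) (hr0 : r 0 = 1)
    (hrec : ∀ n, r (n + 1) = ∑ p ∈ Finset.HasAntidiagonal.antidiagonal n, q p.1 * r p.2) :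
    Summable fun n => |r n| := by
  have hnn : ∀ n, 0 ≤ r n := by
    intro n
    induction n using Nat.strong_induction_on with
    | _ n ih =>
      cases n with
      | zero => rw [hr0]; exact zero_le_one
      | succ n =>
        rw [hrec]
        refine Finset.sum_nonneg fun p hp => mul_nonneg (hq _) (ih _ ?_)
        have := Finset.HasAntidiagonal.mem_antidiagonal.1 hp
        omega
  simp_rw [abs_of_nonneg (hnn _)]
  have hmono : Monotone fun M => ∑ p ∈ Finset.range M, r p :=
    fun i j hij => Finset.sum_le_sum_of_subset_of_nonneg (Finset.range_mono hij) fun _ _ _ => hnn _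
  refine summable_of_sum_range_le (c := 1 / (1 - ∑' n, q n)) hnn fun M => ?_
  rw [le_div_iff₀ (by linarith)]
  have h1 : ∑ n ∈ Finset.range (M + 1), r n ≤ 1 + (∑' n, q n) * ∑ n ∈ Finset.range M, r n := by
    rw [Finset.sum_range_succ', hr0, add_comm]
    gcongr
    calc ∑ n ∈ Finset.range M, r (n + 1)
        = ∑ n ∈ Finset.range M, ∑ i ∈ Finset.range (n + 1), q i * r (n - i) := by
          refine Finset.sum_congr rfl fun n _ => ?_
          rw [hrec, Finset.Nat.sum_antidiagonal_eq_sum_range_succ (fun i j => q i * r j)]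
      _ = ∑ i ∈ Finset.range M, ∑ j ∈ Finset.range (M - i), q i * r j :=
          Finset.sum_range_diag_flip M fun i j => q i * r j
      _ ≤ ∑ i ∈ Finset.range M, q i * ∑ j ∈ Finset.range M, r j := by
          refine Finset.sum_le_sum fun i _ => ?_
          rw [← Finset.mul_sum]
          exact mul_le_mul_of_nonneg_left (hmono (Nat.sub_le M i)) (hq i)
      _ = (∑ i ∈ Finset.range M, q i) * ∑ j ∈ Finset.range M, r j := (Finset.sum_mul ..).symm
      _ ≤ _ := by
          gcongr
          · exact Finset.sum_nonneg fun _ _ => hnn _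
          · exact hqs.sum_le_tsum _ fun _ _ => hq _
  have h2 := hmono (Nat.le_succ M)
  simp only [Nat.succ_eq_add_one] at h2
  linarith

/-- The generating function identity R(z)(1 - zQ(z)) = 1 at z = 1. -/
theorem tsum_mul_one_sub_tsum_of_renewal {q r : ℕ → ℝ} (hq : Summable fun n => |q n|)
    (hr : Summable fun n => |r n|) (hr0 : r 0 = 1)
    (hrec : ∀ n, r (n + 1) = ∑ p ∈ Finset.HasAntidiagonal.antidiagonal n, q p.1 * r p.2) :
    (∑' n, r n) * (1 - ∑' n, q n) = 1 := by
  have h1 := hr.of_abs.tsum_eq_zero_add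
  have h2 := tsum_mul_tsum_eq_tsum_sum_antidiagonal_of_summable_norm (f := q) (g := r) hq hr
  simp_rw [← hrec] at h2
  rw [hr0] at h1
  linear_combination h1 - h2

theorem mainTheorem9 {Ω : Type*} [MeasurableSpace Ω] (μ : Measure Ω) [IsProbabilityMeasure μ]
    (a α σ : ℝ) (k r : ℕ → ℝ) (ξ : ℤ → Ω → ℝ)
    (hα : 0 < α) (hσ : σ ≠ 0)
    (hk : IsRegularlyVaryingSeq k (-1 - α))
    (hak : a + ∑' j : ℕ, k (j + 1) < 0)
    (hr : IsFundamentalSolution a k r)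
    (hstab : a < -1 → Summable fun n : ℕ => |r n|)
    (hξ : IsIIDNoise μ ξ σ) :
    (Summable fun j : ℕ => k (j + 1)) ∧
      (Summable fun n : ℕ => |r n|) ∧
      (∃ X : ℤ → Ω → ℝ, IsVolterraProcess μ a k r ξ X) ∧
      (∀ X : ℤ → Ω → ℝ, IsVolterraProcess μ a k r ξ X →
        ∃ c : ℕ → ℝ, IsAutocovariance μ X c ∧
          Tendsto (fun h : ℕ => c h / k h) atTop
            (𝓝 (σ ^ 2 / (-a - ∑' j : ℕ, k (j + 1)) ^ 3))) ∧
      0 < σ ^ 2 / (-a - ∑' j : ℕ, k (j + 1)) ^ 3 := by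
  obtain ⟨C, hw⟩ := hk.exists_isSubexponentialWeight hα
  -- `k 0` is arbitrary, so index 0 is reset: to 1 in `w` for positivity, to 1 + a in `q` to absorb
  -- the linear term.
  set w : ℕ → ℝ := fun n => if n = 0 then 1 else k n with hwdef
  set q : ℕ → ℝ := fun n => if n = 0 then 1 + a else k n with hqdef
  have hwk : ∀ n, 1 ≤ n → w n = k n := fun n hn => by simp [hwdef, show n ≠ 0 by omega]
  have hqk : ∀ n, 1 ≤ n → q n = k n := fun n hn => by simp [hqdef, show n ≠ 0 by omega]
  have hq0 : q 0 = 1 + a := by simp [hqdef]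
  have hqw : Tendsto (fun n => q n / w n) atTop (𝓝 1) := by
    refine tendsto_const_nhds.congr' ?_
    filter_upwards [eventually_ge_atTop 1] with n hn
    rw [hqk n hn, ← hwk n hn, div_self (hw.pos n).ne']
  have hqs := hw.summable_abs hqw
  have hks : Summable fun j : ℕ => k (j + 1) :=
    ((summable_nat_add_iff 1).2 hqs.of_abs).congr fun j => hqk _ (by omega)
  have hqsum : ∑' n, q n = 1 + a + ∑' j : ℕ, k (j + 1) := by
    rw [hqs.of_abs.tsum_eq_zero_add, hq0]
    exact congrArg _ (tsum_congr fun j => hqk _ (by omega))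
  have hrec := hr.renewal hq0 hqk
  have hrs : Summable fun n : ℕ => |r n| := by
    rcases lt_or_ge a (-1) with ha | ha
    · exact hstab ha
    · refine summable_of_renewal_of_nonneg (fun n => ?_) hqs.of_abs (by linarith) hr.1 hrec
      rcases Nat.eq_zero_or_pos n with rfl | hn
      · rw [hq0]; linarith
      · rw [hqk n hn]; exact (hk.1 n hn).le
  set d := -a - ∑' j : ℕ, k (j + 1) with hd
  have hd0 : 0 < d := by linarith
  have hR : ∑' n, r n = 1 / d := by
    rw [eq_div_iff hd0.ne', ← tsum_mul_one_sub_tsum_of_renewal hqs hrs hr.1 hrec, hqsum, hd]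
    ring
  refine ⟨hks, hrs, ⟨_, hξ.isVolterraProcess_linearProcess hq0 hqk hqs hrs hr.1 hrec⟩,
    fun X hX => ⟨_, hξ.isAutocovariance_of_ae_eq_linearProcess hrs
      (hX.ae_eq_linearProcess hξ hq0 hqk hqs hrs hr.1 hrec), ?_⟩, by positivity⟩
  have hlim := (hw.tendsto_tsum_mul_shift
    (hw.tendsto_renewal hqw hr.1 hrec hrs)).const_mul (σ ^ 2)
  rw [hR, show σ ^ 2 * (1 / d * (1 / d) ^ 2) = σ ^ 2 / d ^ 3 by field_simp] at hlim
  refine hlim.congr' ?_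
  filter_upwards [eventually_ge_atTop 1] with h hh
  rw [hwk h hh, mul_div_assoc]
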